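/- For $\beta\in(0,1]$ let $\mathrm{E}_\beta(z)=\sum_{n=0}^\infty \frac{z^n}{\Gamma(\beta n+1)}$, $z\in\mathbb{C}$, be the Mittag-Leffler function, and for $d\in\{1,2\}$ let $\mu_\beta^d$ be the Mittag-Leffler measure on $\mathbb{R}^d$, i.e. the unique probability measure with \[ \int_{\mathbb{R}^d}\exp(\mathrm{i}(p,x))\,\mathrm{d}\mu_\beta^d(x)=\mathrm{E}_\beta\Bigl(-\frac12(p,p)\Bigr)\quad\text{for all }p\in\mathbb{R}^d. \] Let $H_n^\beta$, $n=0,1,2,\dots$, be the monic polynomials with $\deg H_n^\beta=n$ obtained by applying Gram--Schmidt orthogonalization (without normalization) to the monomials $1,x,x^2,\dots$ in $L^2(\mathbb{R},\mu_\beta^1)$. Then, for every $\beta\in(0,1]$, the function $(x,y)\mapsto H_4^\beta(x)H_2^\beta(y)$ is integrable with respect to $\mu_\beta^2$, and \[ \int_{\mathbb{R}^2}H_4^\beta(x)H_2^\beta(y)\,\mathrm{d}\mu_\beta^2(x,y)=0\quad\text{if and only if}\quad\beta=1. \] -/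

import Mathlib

open MeasureTheory

noncomputable section

/-- The Mittag-Leffler function `E_β(z) = ∑ zⁿ / Γ(β n + 1)`. -/
def mittagLeffler (β : ℝ) (z : ℂ) : ℂ :=
  ∑' n : ℕ, z ^ n / Complex.Gamma (β * n + 1)

/-- `μ` is a probability measure with characteristic function `p ↦ E_β(-(p,p)/2)`. -/
def IsMittagLefflerMeasure {E : Type*} [NormedAddCommGroup E] [InnerProductSpace ℝ E]
    [MeasurableSpace E] (β : ℝ) (μ : Measure E) : Prop :=
  IsProbabilityMeasure μ ∧
    ∀ p : E, charFun μ p = mittagLeffler β (-(1 / 2) * (inner ℝ p p : ℝ))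

/-- A measure is determined by its characteristic function, so there is at most one
Mittag-Leffler measure on a given Euclidean space. -/
theorem IsMittagLefflerMeasure.unique {E : Type*} [NormedAddCommGroup E] [InnerProductSpace ℝ E]
    [FiniteDimensional ℝ E] [MeasurableSpace E] [BorelSpace E] {β : ℝ} {μ ν : Measure E}
    (hμ : IsMittagLefflerMeasure β μ) (hν : IsMittagLefflerMeasure β ν) : μ = ν := by
  have := hμ.1
  have := hν.1
  have : CompleteSpace E := FiniteDimensional.complete ℝ E
  exact Measure.ext_of_charFun (funext fun p => (hμ.2 p).trans (hν.2 p).symm)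

open Classical in
/-- The Mittag-Leffler measure `μ_β` on the Euclidean space `E`: the unique probability measure
with characteristic function `p ↦ E_β(-(p,p)/2)`. (The value `0` is only there to make the
definition total.) -/
def mittagLefflerMeasure (β : ℝ) (E : Type*) [NormedAddCommGroup E] [InnerProductSpace ℝ E]
    [MeasurableSpace E] : Measure E :=
  if h : ∃ μ : Measure E, IsMittagLefflerMeasure β μ then h.choose else 0

/-- The monic polynomials obtained from the monomials `1, x, x², …` by Gram-Schmidt
orthogonalization (without normalization) in `L²(ℝ, μ)`. -/
def gramSchmidtPoly (μ : Measure ℝ) (n : ℕ) : Polynomial ℝ :=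
  Polynomial.X ^ n - ∑ k : Fin n,
    Polynomial.C ((∫ x, x ^ n * (gramSchmidtPoly μ k).eval x ∂μ) /
      ∫ x, (gramSchmidtPoly μ k).eval x ^ 2 ∂μ) * gramSchmidtPoly μ k
termination_by n
decreasing_by all_goals exact k.2

/-- The polynomials `H_n^β`, orthogonal in `L²(ℝ, μ_β)` for the one-dimensional measure. -/
def mittagLefflerPoly (β : ℝ) (n : ℕ) : Polynomial ℝ :=
  gramSchmidtPoly (mittagLefflerMeasure β ℝ) n

end


/-!
The numbers `c m = m! / Γ(β m + 1)` are the moments of a law `ρ` on `[0, ∞)`: by Euler's product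
they are limits of products of the sequences `r ^ m` and `(β m + a) / (m + a)`, and moment sequences
are stable under products and limits. Hence, in every dimension, the Mittag-Leffler measure is the
law of `√T Z` with `T ∼ ρ` independent of a standard Gaussian vector `Z`, and its mixed moments are
those of `Z` scaled by `c`. After computing `H₂` and `H₄`, the integral becomes a positive multiple
of `2 c₁² c₃ - c₂ c₃ - c₁ c₂²`. For `β = 1` all moments are `1` and this vanishes. For `β < 1` it is
negative: up to a positive factor, its opposite is the integral over `[0, 1]` of
`x^β (1 - x)^(-β)` times a quadratic polynomial in `x^β` with negative discriminant.
-/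

open Filter Topology ProbabilityTheory
open scoped Nat NNReal ENNReal

/-! ### Moments of weak limits -/

section Truncation

variable {X : Type*} [MeasurableSpace X] {μ : Measure X} [IsFiniteMeasure μ] {f : X → ℝ}

theorem sub_sq_div_le_min (x : ℝ) {a : ℝ} (ha : 0 < a) : x - x ^ 2 / a ≤ min x a := by
  refine le_min (sub_le_self x (by positivity)) ?_
  rw [sub_le_iff_le_add, ← sub_le_iff_le_add', le_div_iff₀ ha]
  nlinarith [sq_nonneg (x - a)]

theorem integrable_min_const (hf : AEStronglyMeasurable f μ) (hf0 : 0 ≤ f) {a : ℝ} (ha : 0 ≤ a) :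
    Integrable (fun x => min (f x) a) μ := by
  refine Integrable.of_bound (hf.inf aestronglyMeasurable_const) a (ae_of_all _ fun x => ?_)
  rw [Real.norm_of_nonneg (le_min (hf0 x) ha)]
  exact min_le_right _ _

theorem integral_sub_integral_sq_div_le_integral_min (hf : MemLp f 2 μ) (hf0 : 0 ≤ f) {a : ℝ}
    (ha : 0 < a) : ∫ x, f x ∂μ - (∫ x, f x ^ 2 ∂μ) / a ≤ ∫ x, min (f x) a ∂μ := by
  have hint : Integrable f μ := hf.integrable one_le_two
  have hsq : Integrable (fun x => f x ^ 2 / a) μ := hf.integrable_sq.div_const a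
  rw [← integral_div, ← integral_sub hint hsq]
  exact integral_mono (hint.sub hsq) (integrable_min_const hint.1 hf0 ha.le)
    fun x => sub_sq_div_le_min (f x) ha

theorem tendsto_min_natCast (x : ℝ) : Tendsto (fun n : ℕ => min x n) atTop (𝓝 x) :=
  tendsto_const_nhds.congr' <| (eventually_ge_atTop ⌈x⌉₊).mono fun _ hn =>
    (min_eq_left (Nat.ceil_le.1 hn)).symm

theorem monotone_min_natCast (x : ℝ) : Monotone fun n : ℕ => min x (n : ℝ) :=
  fun _ _ h => min_le_min_left x (Nat.cast_le.2 h)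

theorem integrable_of_forall_integral_min_le (hf : AEStronglyMeasurable f μ) (hf0 : 0 ≤ f) {C : ℝ}
    (hC : ∀ n : ℕ, ∫ x, min (f x) n ∂μ ≤ C) : Integrable f μ := by
  have hlim : Tendsto (fun n : ℕ => ∫⁻ x, ENNReal.ofReal (min (f x) n) ∂μ) atTop
      (𝓝 (∫⁻ x, ENNReal.ofReal (f x) ∂μ)) :=
    lintegral_tendsto_of_tendsto_of_monotone
      (fun n => (hf.inf aestronglyMeasurable_const).aemeasurable.ennreal_ofReal)
      (ae_of_all _ fun x => ENNReal.ofReal_mono.comp (monotone_min_natCast (f x)))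
      (ae_of_all _ fun x => ENNReal.tendsto_ofReal (tendsto_min_natCast (f x)))
  have hle : ∫⁻ x, ENNReal.ofReal (f x) ∂μ ≤ ENNReal.ofReal C := by
    refine le_of_tendsto' hlim fun n => ?_
    rw [← ofReal_integral_eq_lintegral_ofReal (integrable_min_const hf hf0 n.cast_nonneg)
      (ae_of_all _ fun x => le_min (hf0 x) n.cast_nonneg)]
    exact ENNReal.ofReal_le_ofReal (hC n)
  exact ⟨hf, (hasFiniteIntegral_iff_ofReal (ae_of_all _ hf0)).2
    (hle.trans_lt ENNReal.ofReal_lt_top)⟩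

theorem tendsto_integral_min_natCast (hf : Integrable f μ) (hf0 : 0 ≤ f) :
    Tendsto (fun n : ℕ => ∫ x, min (f x) n ∂μ) atTop (𝓝 (∫ x, f x ∂μ)) :=
  integral_tendsto_of_tendsto_of_monotone
    (fun n => integrable_min_const hf.1 hf0 n.cast_nonneg) hf
    (ae_of_all _ fun x => monotone_min_natCast (f x))
    (ae_of_all _ fun x => tendsto_min_natCast (f x))

end Truncation

section WeakLimit

variable {X : Type*} [TopologicalSpace X] [MeasurableSpace X]

theorem isTightMeasureSet_of_lintegral_le {S : Set (Measure X)} {f : X → ℝ≥0} (hf : Measurable f)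
    (hcompact : ∀ r, IsCompact {x | f x ≤ r}) {C : ℝ≥0} (hS : ∀ μ ∈ S, ∫⁻ x, f x ∂μ ≤ C) :
    IsTightMeasureSet S := by
  refine isTightMeasureSet_iff_exists_isCompact_measure_compl_le.2 fun ε hε => ?_
  have hCε : (C : ℝ≥0∞) / ε ≠ ∞ := ENNReal.div_ne_top ENNReal.coe_ne_top hε.ne'
  obtain ⟨r, hr⟩ : ∃ r : ℝ≥0, (C : ℝ≥0∞) / ε < r := ENNReal.lt_iff_exists_nnreal_btwn.1
    hCε.lt_top |>.imp fun _ h => h.1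
  refine ⟨{x | f x ≤ r}, hcompact r, fun μ hμ => ?_⟩
  calc μ {x | f x ≤ r}ᶜ
      ≤ μ {x | (r : ℝ≥0∞) ≤ f x} :=
        measure_mono fun x (hx : ¬f x ≤ r) => ENNReal.coe_le_coe.2 (not_le.1 hx).le
    _ ≤ (∫⁻ x, f x ∂μ) / r :=
        meas_ge_le_lintegral_div (by fun_prop) (bot_le.trans_lt hr).ne' ENNReal.coe_ne_top
    _ ≤ C / r := ENNReal.div_le_div_right (hS μ hμ) _
    _ ≤ ε := ENNReal.div_le_of_le_mul <|
        (ENNReal.div_le_iff_le_mul (.inl hε.ne') (.inr (bot_le.trans_lt hr).ne')).1 hr.le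
          |>.trans_eq (mul_comm _ _)

variable [OpensMeasurableSpace X] {ι : Type*} {l : Filter ι} {μ : ι → ProbabilityMeasure X}
  {ν : ProbabilityMeasure X} {f : X → ℝ}

theorem tendsto_integral_min_of_tendsto (hμ : Tendsto μ l (𝓝 ν)) (hf : Continuous f) (hf0 : 0 ≤ f)
    {a : ℝ} (ha : 0 ≤ a) :
    Tendsto (fun i => ∫ x, min (f x) a ∂(μ i : Measure X)) l (𝓝 (∫ x, min (f x) a ∂ν)) :=
  ProbabilityMeasure.tendsto_iff_forall_integral_tendsto.1 hμ <|
    BoundedContinuousFunction.ofNormedAddCommGroup (fun x => min (f x) a)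
      (hf.min continuous_const) a fun x => by
        rw [Real.norm_of_nonneg (le_min (hf0 x) ha)]
        exact min_le_right _ _

variable [l.NeBot] {C b : ℝ}

theorem integral_min_le_of_tendsto (hμ : Tendsto μ l (𝓝 ν)) (hf : Continuous f) (hf0 : 0 ≤ f)
    (hint : ∀ i, Integrable f (μ i : Measure X))
    (hb : Tendsto (fun i => ∫ x, f x ∂(μ i : Measure X)) l (𝓝 b)) {a : ℝ} (ha : 0 ≤ a) :
    ∫ x, min (f x) a ∂ν ≤ b :=
  le_of_tendsto_of_tendsto' (tendsto_integral_min_of_tendsto hμ hf hf0 ha) hb fun i =>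
    integral_mono (integrable_min_const (hint i).1 hf0 ha) (hint i) fun _ => min_le_left _ _

theorem sub_div_le_integral_min_of_tendsto (hμ : Tendsto μ l (𝓝 ν)) (hf : Continuous f)
    (hf0 : 0 ≤ f) (hL2 : ∀ i, MemLp f 2 (μ i : Measure X))
    (hC : ∀ i, ∫ x, f x ^ 2 ∂(μ i : Measure X) ≤ C)
    (hb : Tendsto (fun i => ∫ x, f x ∂(μ i : Measure X)) l (𝓝 b)) {a : ℝ} (ha : 0 < a) :
    b - C / a ≤ ∫ x, min (f x) a ∂ν :=
  le_of_tendsto_of_tendsto' (hb.sub_const (C / a)) (tendsto_integral_min_of_tendsto hμ hf hf0 ha.le)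
    fun i => (sub_le_sub_left (div_le_div_of_nonneg_right (hC i) ha.le) _).trans
      (integral_sub_integral_sq_div_le_integral_min (hL2 i) hf0 ha)

theorem integrable_and_integral_eq_of_tendsto (hμ : Tendsto μ l (𝓝 ν)) (hf : Continuous f)
    (hf0 : 0 ≤ f) (hL2 : ∀ i, MemLp f 2 (μ i : Measure X))
    (hC : ∀ i, ∫ x, f x ^ 2 ∂(μ i : Measure X) ≤ C)
    (hb : Tendsto (fun i => ∫ x, f x ∂(μ i : Measure X)) l (𝓝 b)) :
    Integrable f (ν : Measure X) ∧ ∫ x, f x ∂ν = b := by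
  have hle (n : ℕ) : ∫ x, min (f x) n ∂ν ≤ b :=
    integral_min_le_of_tendsto hμ hf hf0 (fun i => (hL2 i).integrable one_le_two) hb n.cast_nonneg
  have hint : Integrable f (ν : Measure X) :=
    integrable_of_forall_integral_min_le hf.measurable.aestronglyMeasurable hf0 hle
  have hlim := tendsto_integral_min_natCast hint hf0
  have hlower : Tendsto (fun n : ℕ => b - C / n) atTop (𝓝 b) := by
    simpa using (tendsto_const_div_atTop_nhds_zero_nat C).const_sub b
  refine ⟨hint, tendsto_nhds_unique hlim (tendsto_of_tendsto_of_tendsto_of_le_of_le' hlower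
    tendsto_const_nhds ?_ (Eventually.of_forall hle))⟩
  filter_upwards [eventually_gt_atTop 0] with n hn
  exact sub_div_le_integral_min_of_tendsto hμ hf hf0 hL2 hC hb (Nat.cast_pos.2 hn)

end WeakLimit

/-! ### Stieltjes moment sequences -/

/-- `ρ` is a probability measure on `[0, ∞)` whose moments of every order are finite and given by
the sequence `c`. -/
structure HasMoments (ρ : Measure ℝ≥0) (c : ℕ → ℝ) : Prop where
  isProbabilityMeasure : IsProbabilityMeasure ρ
  integrable_pow (m : ℕ) : Integrable (fun t : ℝ≥0 => (t : ℝ) ^ m) ρ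
  integral_pow (m : ℕ) : ∫ t : ℝ≥0, (t : ℝ) ^ m ∂ρ = c m

/-- A sequence of moments of some probability measure on `[0, ∞)`, the measure being left
unspecified. This is the solvability of the Stieltjes moment problem for `c`. -/
def IsStieltjesMomentSeq (c : ℕ → ℝ) : Prop :=
  ∃ ρ : Measure ℝ≥0, HasMoments ρ c

namespace HasMoments

variable {ρ ρ₁ ρ₂ : Measure ℝ≥0} {c c₁ c₂ : ℕ → ℝ}

theorem memLp_pow (h : HasMoments ρ c) (m : ℕ) : MemLp (fun t : ℝ≥0 => (t : ℝ) ^ m) 2 ρ := by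
  refine (memLp_two_iff_integrable_sq (h.integrable_pow m).1).2 ?_
  simpa only [← pow_mul] using h.integrable_pow (m * 2)

theorem sq_apply_le (h : HasMoments ρ c) (m : ℕ) : c m ^ 2 ≤ c (m * 2) := by
  have := h.isProbabilityMeasure
  have hvar := variance_nonneg (fun t : ℝ≥0 => (t : ℝ) ^ m) ρ
  rw [variance_eq_sub (h.memLp_pow m)] at hvar
  simpa only [Pi.pow_apply, ← pow_mul, h.integral_pow, sub_nonneg] using hvar

theorem dirac (r : ℝ≥0) : HasMoments (Measure.dirac r) fun m => (r : ℝ) ^ m where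
  isProbabilityMeasure := inferInstance
  integrable_pow m := integrable_dirac (by finiteness)
  integral_pow m := integral_dirac _ _

theorem map {Ω : Type*} [MeasurableSpace Ω] {P : Measure Ω} [IsProbabilityMeasure P] {T : Ω → ℝ≥0}
    (hT : Measurable T) (hint : ∀ m, Integrable (fun ω => (T ω : ℝ) ^ m) P)
    (hc : ∀ m, ∫ ω, (T ω : ℝ) ^ m ∂P = c m) : HasMoments (P.map T) c where
  isProbabilityMeasure := Measure.isProbabilityMeasure_map hT.aemeasurable
  integrable_pow m := (integrable_map_measure (by fun_prop) hT.aemeasurable).2 (hint m)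
  integral_pow m := (integral_map hT.aemeasurable (by fun_prop)).trans (hc m)

theorem mul (h₁ : HasMoments ρ₁ c₁) (h₂ : HasMoments ρ₂ c₂) :
    HasMoments ((ρ₁.prod ρ₂).map fun q => q.1 * q.2) fun m => c₁ m * c₂ m := by
  have := h₁.isProbabilityMeasure
  have := h₂.isProbabilityMeasure
  refine .map (by fun_prop) (fun m => ?_) fun m => ?_
  · simpa only [NNReal.coe_mul, mul_pow] using (h₁.integrable_pow m).mul_prod (h₂.integrable_pow m)
  · simp only [NNReal.coe_mul, mul_pow]
    rw [integral_prod_mul (fun t : ℝ≥0 => (t : ℝ) ^ m) fun t : ℝ≥0 => (t : ℝ) ^ m,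
      h₁.integral_pow, h₂.integral_pow]

theorem convexCombination (h₁ : HasMoments ρ₁ c₁) (h₂ : HasMoments ρ₂ c₂) {a b : ℝ≥0}
    (hab : a + b = 1) : HasMoments (a • ρ₁ + b • ρ₂) fun m => a * c₁ m + b * c₂ m := by
  have := h₁.isProbabilityMeasure
  have := h₂.isProbabilityMeasure
  have hint₁ (m : ℕ) := (h₁.integrable_pow m).smul_measure_nnreal (c := a)
  have hint₂ (m : ℕ) := (h₂.integrable_pow m).smul_measure_nnreal (c := b)
  refine ⟨⟨?_⟩, fun m => (hint₁ m).add_measure (hint₂ m), fun m => ?_⟩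
  · rw [Measure.add_apply, Measure.smul_apply, Measure.smul_apply, measure_univ, measure_univ,
      ← add_smul, hab, one_smul]
  · rw [integral_add_measure (hint₁ m) (hint₂ m), integral_smul_nnreal_measure,
      integral_smul_nnreal_measure, h₁.integral_pow, h₂.integral_pow, NNReal.smul_def,
      NNReal.smul_def, smul_eq_mul, smul_eq_mul]

theorem isTightMeasureSet_range {ρ : ℕ → ProbabilityMeasure ℝ≥0} {c : ℕ → ℕ → ℝ}
    (h : ∀ n, HasMoments (ρ n) (c n)) (hbdd : BddAbove (Set.range fun n => c n 1)) :
    IsTightMeasureSet {(μ : Measure ℝ≥0) | μ ∈ Set.range ρ} := by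
  obtain ⟨C, hC⟩ := hbdd
  have hmean (n : ℕ) : ∫⁻ t : ℝ≥0, t ∂ρ n = ENNReal.ofReal (c n 1) := by
    rw [← (h n).integral_pow, ofReal_integral_eq_lintegral_ofReal ((h n).integrable_pow 1)
      (ae_of_all _ fun _ => by positivity)]
    simp
  refine isTightMeasureSet_of_lintegral_le (f := id) (C := C.toNNReal) measurable_id
    (fun r => ?_) ?_
  · rw [show {t : ℝ≥0 | id t ≤ r} = Set.Icc 0 r by ext; simp]
    exact isCompact_Icc
  · rintro _ ⟨_, ⟨n, rfl⟩, rfl⟩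
    exact (hmean n).trans_le (ENNReal.ofReal_le_ofReal (hC (Set.mem_range_self n)))

theorem exists_ultrafilter_tendsto {ρ : ℕ → ProbabilityMeasure ℝ≥0} {c : ℕ → ℕ → ℝ}
    (h : ∀ n, HasMoments (ρ n) (c n)) (hbdd : BddAbove (Set.range fun n => c n 1)) :
    ∃ (ν : ProbabilityMeasure ℝ≥0) (U : Ultrafilter ℕ), ↑U ≤ (atTop : Filter ℕ) ∧
      Tendsto ρ U (𝓝 ν) := by
  have hmem : ∀ᶠ n in atTop, ρ n ∈ closure (Set.range ρ) :=
    Eventually.of_forall fun n => subset_closure (Set.mem_range_self n)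
  obtain ⟨ν, -, hν⟩ := (isCompact_closure_of_isTightMeasureSet
    (isTightMeasureSet_range h hbdd)).exists_mapClusterPt (le_principal_iff.2 hmem)
  exact ⟨ν, mapClusterPt_iff_ultrafilter.1 hν⟩

end HasMoments

namespace IsStieltjesMomentSeq

variable {c c₁ c₂ : ℕ → ℝ}

theorem const_pow (r : ℝ≥0) : IsStieltjesMomentSeq fun m => (r : ℝ) ^ m :=
  ⟨_, HasMoments.dirac r⟩

theorem mul (h₁ : IsStieltjesMomentSeq c₁) (h₂ : IsStieltjesMomentSeq c₂) :
    IsStieltjesMomentSeq fun m => c₁ m * c₂ m :=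
  let ⟨_, h₁⟩ := h₁
  let ⟨_, h₂⟩ := h₂
  ⟨_, h₁.mul h₂⟩

theorem convexCombination (h₁ : IsStieltjesMomentSeq c₁) (h₂ : IsStieltjesMomentSeq c₂) {a b : ℝ}
    (ha : 0 ≤ a) (hb : 0 ≤ b) (hab : a + b = 1) :
    IsStieltjesMomentSeq fun m => a * c₁ m + b * c₂ m := by
  obtain ⟨_, h₁⟩ := h₁
  obtain ⟨_, h₂⟩ := h₂
  lift a to ℝ≥0 using ha
  lift b to ℝ≥0 using hb
  exact ⟨_, h₁.convexCombination h₂ (mod_cast hab)⟩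

theorem prod {ι : Type*} {c : ι → ℕ → ℝ} (s : Finset ι)
    (h : ∀ i ∈ s, IsStieltjesMomentSeq (c i)) :
    IsStieltjesMomentSeq fun m => ∏ i ∈ s, c i m := by
  classical
  induction s using Finset.induction_on with
  | empty => simpa using const_pow 1
  | insert i s hi ih =>
    simp only [Finset.prod_insert hi]
    exact (h i (Finset.mem_insert_self i s)).mul (ih fun j hj => h j (Finset.mem_insert_of_mem hj))

-- These are the moments of `U ^ (1 / a)` for `U` uniform on `[0, 1]`.
theorem div_natCast_add {a : ℝ} (ha : 0 < a) : IsStieltjesMomentSeq fun m => a / (m + a) := by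
  have hprob : IsProbabilityMeasure (volume.restrict (Set.Ioc (0 : ℝ) 1)) := ⟨by simp⟩
  have hpow (m : ℕ) {u : ℝ} (hu : 0 ≤ u) :
      (u.toNNReal ^ (1 / a) : ℝ≥0) ^ m = u ^ (m / a) := by
    rw [NNReal.coe_rpow, Real.coe_toNNReal u hu, ← Real.rpow_mul_natCast hu, one_div_mul_eq_div]
  have hae (m : ℕ) : (fun u : ℝ => u ^ (m / a)) =ᵐ[volume.restrict (Set.Ioc (0 : ℝ) 1)]
      fun u => (u.toNNReal ^ (1 / a) : ℝ≥0) ^ m :=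
    (ae_restrict_mem measurableSet_Ioc).mono fun u hu => (hpow m hu.1.le).symm
  refine ⟨_, HasMoments.map (P := volume.restrict (Set.Ioc (0 : ℝ) 1))
    (T := fun u => u.toNNReal ^ (1 / a)) (by fun_prop) (fun m => ?_) fun m => ?_⟩
  · refine Integrable.congr ?_ (hae m)
    exact (intervalIntegrable_iff_integrableOn_Ioc_of_le zero_le_one).1
      (intervalIntegral.intervalIntegrable_rpow (.inl (by positivity)))
  · rw [← integral_congr_ae (hae m), ← intervalIntegral.integral_of_le zero_le_one,
      integral_rpow (.inl (neg_one_lt_zero.trans_le (by positivity))), Real.one_rpow,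
      Real.zero_rpow (by positivity)]
    field_simp
    ring

theorem of_tendsto {c : ℕ → ℕ → ℝ} {c' : ℕ → ℝ} (h : ∀ n, IsStieltjesMomentSeq (c n))
    (hc : ∀ m, Tendsto (fun n => c n m) atTop (𝓝 (c' m))) : IsStieltjesMomentSeq c' := by
  have hprob (n : ℕ) : ∃ ρ : ProbabilityMeasure ℝ≥0, HasMoments ρ (c n) :=
    let ⟨ρ, hρ⟩ := h n
    ⟨⟨ρ, hρ.isProbabilityMeasure⟩, hρ⟩
  choose ρ hρ using hprob
  obtain ⟨ν, U, hU, hν⟩ := HasMoments.exists_ultrafilter_tendsto hρ (hc 1).bddAbove_range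
  have hmoment (m : ℕ) : Integrable (fun t : ℝ≥0 => (t : ℝ) ^ m) (ν : Measure ℝ≥0) ∧
      ∫ t : ℝ≥0, (t : ℝ) ^ m ∂ν = c' m := by
    obtain ⟨C, hC⟩ := (hc (m * 2)).bddAbove_range
    refine integrable_and_integral_eq_of_tendsto hν (by fun_prop) (fun _ => by positivity)
      (fun n => (hρ n).memLp_pow m) (C := C) (fun n => ?_) ?_
    · simp only [← pow_mul, (hρ n).integral_pow]
      exact hC (Set.mem_range_self n)
    · simpa only [(hρ _).integral_pow] using (hc m).mono_left hU
  exact ⟨ν, inferInstance, fun m => (hmoment m).1, fun m => (hmoment m).2⟩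

end IsStieltjesMomentSeq

/-! ### The mixing law of the Mittag-Leffler measure -/

/-- The moments `m! / Γ(β m + 1)` of the law of the random variance in the representation of the
Mittag-Leffler measure as a Gaussian mixture. -/
noncomputable def mittagLefflerMoment (β : ℝ) (m : ℕ) : ℝ :=
  m ! / Real.Gamma (β * m + 1)

section Moment

variable {β : ℝ}

theorem Gamma_mul_natCast_add_one_pos (hβ : 0 ≤ β) (m : ℕ) : 0 < Real.Gamma (β * m + 1) :=
  Real.Gamma_pos_of_pos (by positivity)

theorem mittagLefflerMoment_zero (β : ℝ) : mittagLefflerMoment β 0 = 1 := by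
  simp [mittagLefflerMoment]

theorem mittagLefflerMoment_one_left (m : ℕ) : mittagLefflerMoment 1 m = 1 := by
  rw [mittagLefflerMoment, one_mul, Real.Gamma_nat_eq_factorial, div_self]
  exact mod_cast m.factorial_ne_zero

theorem mittagLefflerMoment_pos (hβ : 0 ≤ β) (m : ℕ) : 0 < mittagLefflerMoment β m :=
  div_pos (mod_cast m.factorial_pos) (Gamma_mul_natCast_add_one_pos hβ m)

theorem isStieltjesMomentSeq_mul_add_div_add (hβ : 0 ≤ β) (hβ' : β ≤ 1) {a : ℝ} (ha : 0 < a) :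
    IsStieltjesMomentSeq fun m => (β * m + a) / (m + a) := by
  convert (IsStieltjesMomentSeq.const_pow 1).convexCombination (.div_natCast_add ha) hβ
    (sub_nonneg.2 hβ') (add_sub_cancel β 1) using 2 with m
  have : (m : ℝ) + a ≠ 0 := by positivity
  rw [NNReal.coe_one, one_pow]
  field_simp
  ring

theorem tendsto_rpow_pow_mul_prod_mittagLefflerMoment (hβ : 0 ≤ β) (m : ℕ) :
    Tendsto (fun n : ℕ => ((n : ℝ) ^ (1 - β)) ^ m *
      ∏ j ∈ Finset.range (n + 1), (β * m + (1 + j)) / (m + (1 + j))) atTop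
      (𝓝 (mittagLefflerMoment β m)) := by
  have hΓ := (Real.GammaSeq_tendsto_Gamma (m + 1)).div (Real.GammaSeq_tendsto_Gamma (β * m + 1))
    (Gamma_mul_natCast_add_one_pos hβ m).ne'
  rw [Real.Gamma_nat_eq_factorial] at hΓ
  refine hΓ.congr' ?_
  filter_upwards [eventually_gt_atTop 0] with n hn
  have hn' : (0 : ℝ) < n := Nat.cast_pos.2 hn
  have hpow : (n : ℝ) ^ ((m : ℝ) + 1) = ((n : ℝ) ^ (1 - β)) ^ m * (n : ℝ) ^ (β * m + 1) := by
    rw [← Real.rpow_mul_natCast hn'.le, ← Real.rpow_add hn']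
    ring_nf
  have hprod (x : ℝ) (hx : 0 ≤ x) : ∏ j ∈ Finset.range (n + 1), (x + (1 + j)) ≠ 0 :=
    Finset.prod_ne_zero_iff.2 fun j _ => by positivity
  have := hprod m m.cast_nonneg
  have := hprod (β * m) (by positivity)
  simp only [Pi.div_apply, Real.GammaSeq, hpow, add_assoc, Finset.prod_div_distrib]
  field_simp

theorem isStieltjesMomentSeq_mittagLefflerMoment (hβ : 0 ≤ β) (hβ' : β ≤ 1) :
    IsStieltjesMomentSeq (mittagLefflerMoment β) := by
  refine .of_tendsto (fun n => ?_) (tendsto_rpow_pow_mul_prod_mittagLefflerMoment hβ)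
  have hscale : IsStieltjesMomentSeq fun m => ((n : ℝ) ^ (1 - β)) ^ m := by
    simpa using! IsStieltjesMomentSeq.const_pow ((n : ℝ≥0) ^ (1 - β))
  exact hscale.mul <| .prod _ fun j _ =>
    isStieltjesMomentSeq_mul_add_div_add hβ hβ' (by positivity)

end Moment

/-! ### The Mittag-Leffler function as a Laplace transform -/

theorem rpow_mul_exp_neg_le_Gamma {R x : ℝ} (hR : 0 ≤ R) (hx : 0 ≤ x) :
    R ^ x * Real.exp (-R) ≤ Real.Gamma (x + 1) := by
  have hint : IntegrableOn (fun t : ℝ => Real.exp (-t) * t ^ x) (Set.Ioi 0) := by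
    simpa using Real.GammaIntegral_convergent (s := x + 1) (by linarith)
  have hsub : Set.Ioi R ⊆ Set.Ioi 0 := Set.Ioi_subset_Ioi hR
  calc R ^ x * Real.exp (-R)
      = ∫ t in Set.Ioi R, R ^ x * Real.exp (-t) := by
        rw [integral_const_mul, integral_exp_neg_Ioi]
    _ ≤ ∫ t in Set.Ioi R, Real.exp (-t) * t ^ x := by
        refine setIntegral_mono_on ((integrableOn_exp_neg_Ioi R).const_mul _)
          (hint.mono_set hsub) measurableSet_Ioi fun t ht => ?_
        rw [mul_comm]
        gcongr
        exact le_of_lt ht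
    _ ≤ ∫ t in Set.Ioi (0 : ℝ), Real.exp (-t) * t ^ x :=
        setIntegral_mono_set hint ((ae_restrict_mem measurableSet_Ioi).mono fun t (ht : 0 < t) =>
          mul_nonneg (Real.exp_nonneg _) (Real.rpow_nonneg ht.le x)) hsub.eventuallyLE
    _ = Real.Gamma (x + 1) := by simp [Real.Gamma_eq_integral (by linarith : 0 < x + 1)]

-- Taking `R ^ β = s + 1` in the bound on `Γ` leaves a geometric series of ratio `s / (s + 1)`.
theorem summable_pow_div_Gamma {β : ℝ} (hβ : 0 < β) {s : ℝ} (hs : 0 ≤ s) :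
    Summable fun n : ℕ => s ^ n / Real.Gamma (β * n + 1) := by
  set R : ℝ := (s + 1) ^ β⁻¹
  have hR : 0 ≤ R := by positivity
  have hΓ (n : ℕ) : (s + 1) ^ n * Real.exp (-R) ≤ Real.Gamma (β * n + 1) := by
    have := rpow_mul_exp_neg_le_Gamma hR (by positivity : 0 ≤ β * n)
    rwa [Real.rpow_mul_natCast hR, Real.rpow_inv_rpow (by positivity) hβ.ne'] at this
  have hratio : s / (s + 1) < 1 := (div_lt_one (by positivity)).2 (lt_add_one s)
  refine .of_nonneg_of_le
    (fun n => div_nonneg (pow_nonneg hs n) (Gamma_mul_natCast_add_one_pos hβ.le n).le) (fun n => ?_)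
    ((summable_geometric_of_lt_one (by positivity) hratio).mul_left (Real.exp R))
  calc s ^ n / Real.Gamma (β * n + 1) ≤ s ^ n / ((s + 1) ^ n * Real.exp (-R)) := by
        gcongr
        exact hΓ n
    _ = Real.exp R * (s / (s + 1)) ^ n := by
        rw [Real.exp_neg, div_pow]
        field_simp

theorem HasMoments.integral_cexp_mul {ρ : Measure ℝ≥0} {c : ℕ → ℝ} (h : HasMoments ρ c) {z : ℂ}
    (hsum : Summable fun n : ℕ => ‖z‖ ^ n / n ! * c n) :
    ∫ t : ℝ≥0, Complex.exp (z * (t : ℝ)) ∂ρ = ∑' n : ℕ, z ^ n / n ! * c n := by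
  have hint (n : ℕ) : Integrable (fun t : ℝ≥0 => z ^ n / n ! * ((t : ℝ) ^ n : ℝ)) ρ :=
    (h.integrable_pow n).ofReal.const_mul _
  have hnorm (n : ℕ) :
      ∫ t : ℝ≥0, ‖z ^ n / n ! * ((t : ℝ) ^ n : ℝ)‖ ∂ρ = ‖z‖ ^ n / n ! * c n := by
    simp [integral_const_mul, h.integral_pow]
  have hexp (t : ℝ≥0) :
      Complex.exp (z * (t : ℝ)) = ∑' n : ℕ, z ^ n / n ! * ((t : ℝ) ^ n : ℝ) := by
    rw [Complex.exp_eq_exp_ℂ, NormedSpace.exp_eq_tsum_div]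
    refine tsum_congr fun n => ?_
    push_cast
    rw [mul_pow, mul_div_right_comm]
  calc ∫ t : ℝ≥0, Complex.exp (z * (t : ℝ)) ∂ρ
      = ∑' n : ℕ, ∫ t : ℝ≥0, z ^ n / n ! * ((t : ℝ) ^ n : ℝ) ∂ρ := by
        simp_rw [hexp]
        exact (hasSum_integral_of_summable_integral_norm hint
          (hsum.congr fun n => (hnorm n).symm)).tsum_eq.symm
    _ = ∑' n : ℕ, z ^ n / n ! * c n := tsum_congr fun n => by
        rw [integral_const_mul, integral_complex_ofReal, h.integral_pow]

theorem HasMoments.integral_cexp_mul_eq_mittagLeffler {ρ : Measure ℝ≥0} {β : ℝ} (hβ : 0 < β)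
    (h : HasMoments ρ (mittagLefflerMoment β)) (z : ℂ) :
    ∫ t : ℝ≥0, Complex.exp (z * (t : ℝ)) ∂ρ = mittagLeffler β z := by
  rw [h.integral_cexp_mul]
  · refine tsum_congr fun n => ?_
    have hn : (n ! : ℂ) ≠ 0 := mod_cast n.factorial_ne_zero
    rw [mittagLefflerMoment]
    push_cast
    rw [← Complex.Gamma_ofReal]
    push_cast
    field_simp
  · refine (summable_pow_div_Gamma hβ (norm_nonneg z)).congr fun n => ?_
    have hn : (n ! : ℝ) ≠ 0 := mod_cast n.factorial_ne_zero
    rw [mittagLefflerMoment]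
    field_simp

/-! ### Gaussian moments -/

section GaussianMoments

variable {v : ℝ≥0}

theorem integrable_pow_gaussianReal (v : ℝ≥0) (n : ℕ) :
    Integrable (fun x => x ^ n) (gaussianReal 0 v) :=
  integrable_pow_of_mem_interior_integrableExpSet (X := id) (by simp) n

theorem integrable_gaussianPDFReal_mul_pow (hv : v ≠ 0) (n : ℕ) :
    Integrable fun x => gaussianPDFReal 0 v x * x ^ n := by
  have h := integrable_pow_gaussianReal v n
  rw [gaussianReal_of_var_ne_zero _ hv, integrable_withDensity_iff_integrable_smul' (by fun_prop)
    (ae_of_all _ fun _ => gaussianPDF_lt_top)] at h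
  simpa only [toReal_gaussianPDF, smul_eq_mul] using h

theorem hasDerivAt_neg_mul_gaussianPDFReal (hv : v ≠ 0) (x : ℝ) :
    HasDerivAt (fun x => -v * gaussianPDFReal 0 v x) (gaussianPDFReal 0 v x * x) x := by
  have hv' : (v : ℝ) ≠ 0 := NNReal.coe_ne_zero.2 hv
  have hexponent : HasDerivAt (fun x : ℝ => -(x - 0) ^ 2 / (2 * v)) (-x / v) x := by
    convert! (((hasDerivAt_id x).sub_const 0).pow 2).neg.div_const (2 * (v : ℝ)) using 1
    simp only [id_eq]
    field_simp
    ring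
  convert! (hexponent.exp.const_mul (√(2 * Real.pi * v))⁻¹).const_mul (-(v : ℝ)) using 1
  rw [gaussianPDFReal]
  field_simp

-- Integration by parts, since `x` times the density is the derivative of `-v` times the density.
theorem integral_pow_add_two_gaussianReal (v : ℝ≥0) (n : ℕ) :
    ∫ x, x ^ (n + 2) ∂gaussianReal 0 v = v * (n + 1) * ∫ x, x ^ n ∂gaussianReal 0 v := by
  obtain rfl | hv := eq_or_ne v 0
  · simp
  have hint := integrable_gaussianPDFReal_mul_pow hv
  have hparts := integral_mul_deriv_eq_deriv_mul_of_integrable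
    (u := fun x => x ^ (n + 1)) (v := fun x => -v * gaussianPDFReal 0 v x)
    (u' := fun x => (n + 1) * x ^ n) (v' := fun x => gaussianPDFReal 0 v x * x)
    (fun x _ => by simpa using hasDerivAt_pow (n + 1) x)
    (fun x _ => hasDerivAt_neg_mul_gaussianPDFReal hv x)
    ((hint (n + 2)).congr (ae_of_all _ fun x => by simp only [Pi.mul_apply]; ring))
    (((hint n).const_mul (-v * (n + 1))).congr
      (ae_of_all _ fun x => by simp only [Pi.mul_apply]; ring))
    (((hint (n + 1)).const_mul (-v)).congr
      (ae_of_all _ fun x => by simp only [Pi.mul_apply]; ring))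
  simp only [integral_gaussianReal_eq_integral_smul hv, ← integral_const_mul, smul_eq_mul]
  calc ∫ x, gaussianPDFReal 0 v x * x ^ (n + 2)
      = ∫ x, x ^ (n + 1) * (gaussianPDFReal 0 v x * x) := by
        congr with x
        ring
    _ = ∫ x, v * (n + 1) * (gaussianPDFReal 0 v x * x ^ n) := by
        rw [hparts, ← integral_neg]
        congr with x
        ring

theorem integral_pow_two_mul_add_one_gaussianReal (v : ℝ≥0) (k : ℕ) :
    ∫ x, x ^ (2 * k + 1) ∂gaussianReal 0 v = 0 := by
  induction k with
  | zero => simp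
  | succ k ih => rw [Nat.mul_succ, add_right_comm, integral_pow_add_two_gaussianReal, ih, mul_zero]

theorem integral_pow_two_mul_gaussianReal (v : ℝ≥0) (k : ℕ) :
    ∫ x, x ^ (2 * k) ∂gaussianReal 0 v = v ^ k * (2 * k - 1)‼ := by
  induction k with
  | zero => simp
  | succ k ih =>
    have hdouble : (2 * (k + 1) - 1)‼ = (2 * k + 1) * (2 * k - 1)‼ := by
      cases k with
      | zero => simp
      | succ k => exact Nat.doubleFactorial_add_two (2 * k + 1)
    rw [Nat.mul_succ, integral_pow_add_two_gaussianReal, ih, ← Nat.mul_succ, hdouble]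
    push_cast
    ring

end GaussianMoments

/-! ### Gaussian mixtures -/

/-- The law of `√T • Z` where `T` has law `ρ` and `Z` is an independent standard Gaussian vector
of `E`, that is, the centred Gaussian law with random variance `T`. -/
noncomputable def gaussianMixture (ρ : Measure ℝ≥0) (E : Type*) [NormedAddCommGroup E]
    [InnerProductSpace ℝ E] [FiniteDimensional ℝ E] [MeasurableSpace E] [BorelSpace E] :
    Measure E :=
  (ρ.prod (stdGaussian E)).map fun q => √(q.1 : ℝ) • q.2

section GaussianMixture

variable {E : Type*} [NormedAddCommGroup E] [InnerProductSpace ℝ E] [FiniteDimensional ℝ E]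
  [MeasurableSpace E] [BorelSpace E] {ρ : Measure ℝ≥0} {c : ℕ → ℝ}

theorem measurable_sqrt_smul : Measurable fun q : ℝ≥0 × E => √(q.1 : ℝ) • q.2 := by
  fun_prop

instance [IsProbabilityMeasure ρ] : IsProbabilityMeasure (gaussianMixture ρ E) :=
  Measure.isProbabilityMeasure_map measurable_sqrt_smul.aemeasurable

theorem charFun_gaussianMixture [IsProbabilityMeasure ρ] (p : E) :
    charFun (gaussianMixture ρ E) p =
      ∫ t : ℝ≥0, Complex.exp (-(1 / 2) * (inner ℝ p p : ℝ) * (t : ℝ)) ∂ρ := by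
  have hbounded : Integrable (fun q : ℝ≥0 × E =>
      Complex.exp (inner ℝ (√(q.1 : ℝ) • q.2) p * Complex.I)) (ρ.prod (stdGaussian E)) :=
    .of_bound (by fun_prop) 1 (ae_of_all _ fun q => (Complex.norm_exp_ofReal_mul_I _).le)
  rw [charFun_apply, gaussianMixture, integral_map measurable_sqrt_smul.aemeasurable (by fun_prop),
    integral_prod _ hbounded]
  refine integral_congr_ae (ae_of_all _ fun t => ?_)
  have hstd := charFun_stdGaussian (√(t : ℝ) • p)
  simp only [charFun_apply, real_inner_smul_right] at hstd
  have hnorm : ‖√(t : ℝ) • p‖ ^ 2 = inner ℝ p p * t := by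
    rw [norm_smul, mul_pow, Real.norm_eq_abs, sq_abs, Real.sq_sqrt t.coe_nonneg,
      real_inner_self_eq_norm_sq, mul_comm]
  simp only [real_inner_smul_left, hstd, ← Complex.ofReal_pow, hnorm]
  push_cast
  ring_nf

theorem HasMoments.integrable_sqrt_pow (h : HasMoments ρ c) (k : ℕ) :
    Integrable (fun t : ℝ≥0 => √(t : ℝ) ^ k) ρ := by
  have := h.isProbabilityMeasure
  have hL2 : MemLp (fun t : ℝ≥0 => √(t : ℝ) ^ k) 2 ρ := by
    refine (memLp_two_iff_integrable_sq (by fun_prop)).2 ((h.integrable_pow k).congr ?_)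
    exact ae_of_all _ fun t => by
      simp only [← pow_mul, mul_comm k, pow_mul _ 2, Real.sq_sqrt t.coe_nonneg]
  exact hL2.integrable one_le_two

theorem HasMoments.integral_sqrt_pow_two_mul (h : HasMoments ρ c) (k : ℕ) :
    ∫ t : ℝ≥0, √(t : ℝ) ^ (2 * k) ∂ρ = c k := by
  simp only [pow_mul, Real.sq_sqrt (NNReal.coe_nonneg _), h.integral_pow]

section Homogeneous

variable {f : E → ℝ} {k : ℕ}

theorem HasMoments.integrable_gaussianMixture (h : HasMoments ρ c)
    (hf : Integrable f (stdGaussian E)) (hmeas : Measurable f)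
    (hhom : ∀ (r : ℝ) (x : E), f (r • x) = r ^ k * f x) :
    Integrable f (gaussianMixture ρ E) := by
  have := h.isProbabilityMeasure
  rw [gaussianMixture, integrable_map_measure hmeas.aestronglyMeasurable
    measurable_sqrt_smul.aemeasurable]
  simpa only [Function.comp_def, hhom] using (h.integrable_sqrt_pow k).mul_prod hf

theorem integral_gaussianMixture [SFinite ρ] (hmeas : Measurable f)
    (hhom : ∀ (r : ℝ) (x : E), f (r • x) = r ^ k * f x) :
    ∫ x, f x ∂gaussianMixture ρ E = (∫ t : ℝ≥0, √(t : ℝ) ^ k ∂ρ) * ∫ x, f x ∂stdGaussian E := by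
  rw [gaussianMixture, integral_map measurable_sqrt_smul.aemeasurable
    hmeas.aestronglyMeasurable]
  simp only [hhom]
  exact integral_prod_mul (fun t : ℝ≥0 => √(t : ℝ) ^ k) f

end Homogeneous

theorem stdGaussian_real : stdGaussian ℝ = gaussianReal 0 1 := by
  refine Measure.ext_of_charFun (funext fun t => ?_)
  rw [charFun_stdGaussian, charFun_gaussianReal, Real.norm_eq_abs, ← Complex.ofReal_pow, sq_abs]
  simp [neg_div]

theorem HasMoments.integrable_pow_gaussianMixture (h : HasMoments ρ c) (n : ℕ) :
    Integrable (fun x => x ^ n) (gaussianMixture ρ ℝ) :=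
  h.integrable_gaussianMixture (stdGaussian_real ▸ integrable_pow_gaussianReal 1 n) (by fun_prop)
    fun r x => mul_pow r x n

theorem integral_pow_gaussianMixture [SFinite ρ] (n : ℕ) :
    ∫ x, x ^ n ∂gaussianMixture ρ ℝ =
      (∫ t : ℝ≥0, √(t : ℝ) ^ n ∂ρ) * ∫ x, x ^ n ∂gaussianReal 0 1 := by
  rw [integral_gaussianMixture (f := fun x : ℝ => x ^ n) (by fun_prop) fun r x => mul_pow r x n,
    stdGaussian_real]

theorem integral_pow_two_mul_add_one_gaussianMixture [SFinite ρ] (k : ℕ) :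
    ∫ x, x ^ (2 * k + 1) ∂gaussianMixture ρ ℝ = 0 := by
  rw [integral_pow_gaussianMixture, integral_pow_two_mul_add_one_gaussianReal, mul_zero]

theorem HasMoments.integral_pow_two_mul_gaussianMixture (h : HasMoments ρ c) (k : ℕ) :
    ∫ x, x ^ (2 * k) ∂gaussianMixture ρ ℝ = c k * (2 * k - 1)‼ := by
  have := h.isProbabilityMeasure
  rw [integral_pow_gaussianMixture, h.integral_sqrt_pow_two_mul, integral_pow_two_mul_gaussianReal,
    NNReal.coe_one, one_pow, one_mul]

section Monomial

variable {ι : Type*} [Fintype ι]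

theorem integrable_prod_pow_stdGaussian (a : ι → ℕ) :
    Integrable (fun x : EuclideanSpace ℝ ι => ∏ i, x i ^ a i) (stdGaussian _) := by
  rw [← map_pi_eq_stdGaussian, integrable_map_measure (by fun_prop) (by fun_prop)]
  exact Integrable.fintype_prod fun i => integrable_pow_gaussianReal 1 (a i)

theorem integral_prod_pow_stdGaussian (a : ι → ℕ) :
    ∫ x : EuclideanSpace ℝ ι, ∏ i, x i ^ a i ∂stdGaussian _ =
      ∏ i, ∫ x, x ^ a i ∂gaussianReal 0 1 := by
  rw [← map_pi_eq_stdGaussian, integral_map (by fun_prop) (by fun_prop)]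
  exact integral_fintype_prod_eq_prod fun i x => x ^ a i

theorem prod_smul_apply_pow (a : ι → ℕ) (r : ℝ) (x : EuclideanSpace ℝ ι) :
    ∏ i, (r • x) i ^ a i = r ^ (∑ i, a i) * ∏ i, x i ^ a i := by
  simp only [PiLp.smul_apply, smul_eq_mul, mul_pow, Finset.prod_mul_distrib,
    Finset.prod_pow_eq_pow_sum]

theorem HasMoments.integrable_prod_pow_gaussianMixture (h : HasMoments ρ c) (a : ι → ℕ) :
    Integrable (fun x : EuclideanSpace ℝ ι => ∏ i, x i ^ a i) (gaussianMixture ρ _) :=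
  h.integrable_gaussianMixture (integrable_prod_pow_stdGaussian a) (by fun_prop)
    (prod_smul_apply_pow a)

theorem HasMoments.integral_prod_pow_two_mul_gaussianMixture (h : HasMoments ρ c) (a : ι → ℕ) :
    ∫ x : EuclideanSpace ℝ ι, ∏ i, x i ^ (2 * a i) ∂gaussianMixture ρ _ =
      c (∑ i, a i) * ∏ i, ((2 * a i - 1)‼ : ℝ) := by
  have := h.isProbabilityMeasure
  rw [integral_gaussianMixture (by fun_prop) (prod_smul_apply_pow _), integral_prod_pow_stdGaussian,
    ← Finset.mul_sum, h.integral_sqrt_pow_two_mul]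
  simp only [integral_pow_two_mul_gaussianReal, NNReal.coe_one, one_pow, one_mul]

end Monomial

end GaussianMixture

theorem IsMittagLefflerMeasure.mittagLefflerMeasure_eq {E : Type*} [NormedAddCommGroup E]
    [InnerProductSpace ℝ E] [FiniteDimensional ℝ E] [MeasurableSpace E] [BorelSpace E] {β : ℝ}
    {μ : Measure E} (hμ : IsMittagLefflerMeasure β μ) : mittagLefflerMeasure β E = μ := by
  have hex : ∃ μ : Measure E, IsMittagLefflerMeasure β μ := ⟨μ, hμ⟩
  rw [mittagLefflerMeasure, dif_pos hex]
  exact hex.choose_spec.unique hμ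

theorem HasMoments.mittagLefflerMeasure_eq_gaussianMixture {ρ : Measure ℝ≥0} {β : ℝ} (hβ : 0 < β)
    (h : HasMoments ρ (mittagLefflerMoment β)) (E : Type*) [NormedAddCommGroup E]
    [InnerProductSpace ℝ E] [FiniteDimensional ℝ E] [MeasurableSpace E] [BorelSpace E] :
    mittagLefflerMeasure β E = gaussianMixture ρ E := by
  have := h.isProbabilityMeasure
  refine IsMittagLefflerMeasure.mittagLefflerMeasure_eq ⟨inferInstance, fun p => ?_⟩
  rw [charFun_gaussianMixture, h.integral_cexp_mul_eq_mittagLeffler hβ]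

/-! ### Orthogonal polynomials of low degree -/

section GramSchmidt

variable {μ : Measure ℝ}

theorem integral_pow_mul_pow_sub (hint : ∀ n : ℕ, Integrable (fun x => x ^ n) μ) (a b k : ℕ)
    (r : ℝ) : ∫ x, x ^ a * (x ^ b - r * x ^ k) ∂μ =
      ∫ x, x ^ (a + b) ∂μ - r * ∫ x, x ^ (a + k) ∂μ := by
  rw [← integral_const_mul, ← integral_sub (hint _) ((hint _).const_mul r)]
  congr with x
  ring

theorem gramSchmidtPoly_zero (μ : Measure ℝ) : gramSchmidtPoly μ 0 = 1 := by
  rw [gramSchmidtPoly]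
  simp

theorem gramSchmidtPoly_one (hodd : ∀ k : ℕ, ∫ x, x ^ (2 * k + 1) ∂μ = 0) :
    gramSchmidtPoly μ 1 = .X := by
  have hmean : ∫ x, x ∂μ = 0 := by simpa using hodd 0
  rw [gramSchmidtPoly]
  simp [gramSchmidtPoly_zero, hmean]

variable [IsProbabilityMeasure μ]

theorem integral_pow_sub_integral_sq (hint : ∀ n : ℕ, Integrable (fun x => x ^ n) μ) (n : ℕ) :
    ∫ x, (x ^ n - ∫ y, y ^ n ∂μ) ^ 2 ∂μ = ∫ x, x ^ (n * 2) ∂μ - (∫ x, x ^ n ∂μ) ^ 2 := by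
  have hL2 : MemLp (fun x : ℝ => x ^ n) 2 μ :=
    (memLp_two_iff_integrable_sq (by fun_prop)).2 (by simpa only [← pow_mul] using hint (n * 2))
  rw [← variance_eq_integral (by fun_prop), variance_eq_sub hL2]
  simp only [Pi.pow_apply, pow_mul]

theorem gramSchmidtPoly_two (hodd : ∀ k : ℕ, ∫ x, x ^ (2 * k + 1) ∂μ = 0) :
    gramSchmidtPoly μ 2 = .X ^ 2 - .C (∫ x, x ^ 2 ∂μ) := by
  have hX : ∫ x, x ^ 2 * x ∂μ = 0 := by simpa only [← pow_succ] using hodd 1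
  rw [gramSchmidtPoly]
  simp [gramSchmidtPoly_zero, gramSchmidtPoly_one hodd, hX]

theorem gramSchmidtPoly_three (hint : ∀ n : ℕ, Integrable (fun x => x ^ n) μ)
    (hodd : ∀ k : ℕ, ∫ x, x ^ (2 * k + 1) ∂μ = 0) :
    gramSchmidtPoly μ 3 = .X ^ 3 - .C ((∫ x, x ^ 4 ∂μ) / ∫ x, x ^ 2 ∂μ) * .X := by
  have hone : ∫ x, x ^ 3 ∂μ = 0 := hodd 1
  have hX : ∫ x, x ^ 3 * x ∂μ = ∫ x, x ^ 4 ∂μ := by simp only [← pow_succ, Nat.reduceAdd]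
  have htwo : ∫ x, x ^ 3 * (x ^ 2 - ∫ y, y ^ 2 ∂μ) ∂μ = 0 := by
    simpa [hone, hodd 2] using integral_pow_mul_pow_sub hint 3 2 0 (∫ y, y ^ 2 ∂μ)
  rw [gramSchmidtPoly]
  simp [Fin.sum_univ_three, gramSchmidtPoly_zero, gramSchmidtPoly_one hodd,
    gramSchmidtPoly_two hodd, hone, hX, htwo]

theorem gramSchmidtPoly_four (hint : ∀ n : ℕ, Integrable (fun x => x ^ n) μ)
    (hodd : ∀ k : ℕ, ∫ x, x ^ (2 * k + 1) ∂μ = 0) :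
    gramSchmidtPoly μ 4 = .X ^ 4 - (.C (∫ x, x ^ 4 ∂μ) +
      .C ((∫ x, x ^ 6 ∂μ - (∫ x, x ^ 2 ∂μ) * ∫ x, x ^ 4 ∂μ) /
        (∫ x, x ^ 4 ∂μ - (∫ x, x ^ 2 ∂μ) ^ 2)) * (.X ^ 2 - .C (∫ x, x ^ 2 ∂μ))) := by
  have hX : ∫ x, x ^ 4 * x ∂μ = 0 := by simpa only [← pow_succ] using hodd 2
  have htwo : ∫ x, x ^ 4 * (x ^ 2 - ∫ y, y ^ 2 ∂μ) ∂μ =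
      ∫ x, x ^ 6 ∂μ - (∫ x, x ^ 2 ∂μ) * ∫ x, x ^ 4 ∂μ := by
    simpa using integral_pow_mul_pow_sub hint 4 2 0 (∫ y, y ^ 2 ∂μ)
  have hthree : ∫ x, x ^ 4 * (x ^ 3 - (∫ y, y ^ 4 ∂μ) / (∫ y, y ^ 2 ∂μ) * x) ∂μ = 0 := by
    simpa [hodd 2, hodd 3] using
      integral_pow_mul_pow_sub hint 4 3 1 ((∫ y, y ^ 4 ∂μ) / ∫ y, y ^ 2 ∂μ)
  rw [gramSchmidtPoly]
  simp [Fin.sum_univ_four, gramSchmidtPoly_zero, gramSchmidtPoly_one hodd,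
    gramSchmidtPoly_two hodd, gramSchmidtPoly_three hint hodd, hX, htwo, hthree,
    integral_pow_sub_integral_sq hint 2]

end GramSchmidt

/-! ### Integrals of products of orthogonal polynomials -/

section ProductIntegral

variable {ρ : Measure ℝ≥0} {c : ℕ → ℝ}

theorem HasMoments.apply_zero (h : HasMoments ρ c) : c 0 = 1 := by
  have := h.isProbabilityMeasure
  simp [← h.integral_pow]

theorem HasMoments.integrable_pow_mul_pow_gaussianMixture (h : HasMoments ρ c) (i j : ℕ) :
    Integrable (fun v : EuclideanSpace ℝ (Fin 2) => v 0 ^ i * v 1 ^ j) (gaussianMixture ρ _) := by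
  simpa only [Fin.prod_univ_two] using! h.integrable_prod_pow_gaussianMixture ![i, j]

theorem HasMoments.integral_pow_two_mul_mul_pow_two_mul_gaussianMixture (h : HasMoments ρ c)
    (i j : ℕ) : ∫ v : EuclideanSpace ℝ (Fin 2), v 0 ^ (2 * i) * v 1 ^ (2 * j)
      ∂gaussianMixture ρ _ = c (i + j) * ((2 * i - 1)‼ * (2 * j - 1)‼) := by
  simpa [Fin.prod_univ_two] using h.integral_prod_pow_two_mul_gaussianMixture ![i, j]

theorem HasMoments.integrable_eval_mul_eval_gaussianMixture (h : HasMoments ρ c)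
    (p q : Polynomial ℝ) :
    Integrable (fun v : EuclideanSpace ℝ (Fin 2) => p.eval (v 0) * q.eval (v 1))
      (gaussianMixture ρ _) := by
  simp only [Polynomial.eval_eq_sum_range, Finset.sum_mul_sum, mul_mul_mul_comm]
  exact integrable_finsetSum _ fun i _ => integrable_finsetSum _ fun j _ =>
    (h.integrable_pow_mul_pow_gaussianMixture i j).const_mul _

theorem HasMoments.integral_even_mul_even_gaussianMixture (h : HasMoments ρ c) {m n : ℕ}
    (p : Fin m → ℝ) (q : Fin n → ℝ) :
    ∫ v : EuclideanSpace ℝ (Fin 2), (∑ i, p i * v 0 ^ (2 * i : ℕ)) *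
        (∑ j, q j * v 1 ^ (2 * j : ℕ)) ∂gaussianMixture ρ _ =
      ∑ i, ∑ j, p i * q j *
        (c (i + j) * (((2 * i - 1 : ℕ)‼ : ℝ) * ((2 * j - 1 : ℕ)‼ : ℝ))) := by
  have hint (i : Fin m) (j : Fin n) := (h.integrable_pow_mul_pow_gaussianMixture
    (2 * i) (2 * j)).const_mul (p i * q j)
  simp only [Finset.sum_mul_sum, mul_mul_mul_comm _ (_ ^ _)]
  rw [integral_finsetSum _ fun i _ => integrable_finsetSum _ fun j _ => hint i j]
  refine Finset.sum_congr rfl fun i _ => ?_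
  rw [integral_finsetSum _ fun j _ => hint i j]
  simp only [integral_const_mul, h.integral_pow_two_mul_mul_pow_two_mul_gaussianMixture]

theorem HasMoments.eval_gramSchmidtPoly_two_gaussianMixture (h : HasMoments ρ c) (x : ℝ) :
    (gramSchmidtPoly (gaussianMixture ρ ℝ) 2).eval x = x ^ 2 - c 1 := by
  have := h.isProbabilityMeasure
  have hmoment := h.integral_pow_two_mul_gaussianMixture 1
  norm_num at hmoment
  rw [gramSchmidtPoly_two integral_pow_two_mul_add_one_gaussianMixture, hmoment]
  simp

theorem HasMoments.eval_gramSchmidtPoly_four_gaussianMixture (h : HasMoments ρ c) (x : ℝ) :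
    (gramSchmidtPoly (gaussianMixture ρ ℝ) 4).eval x =
      x ^ 4 - (3 * c 2 + (15 * c 3 - 3 * c 1 * c 2) / (3 * c 2 - c 1 ^ 2) * (x ^ 2 - c 1)) := by
  have := h.isProbabilityMeasure
  have hmoment := h.integral_pow_two_mul_gaussianMixture
  have h₂ := hmoment 1
  have h₄ := hmoment 2
  have h₆ := hmoment 3
  norm_num [Nat.doubleFactorial] at h₂ h₄ h₆
  rw [gramSchmidtPoly_four h.integrable_pow_gaussianMixture
    integral_pow_two_mul_add_one_gaussianMixture, h₂, h₄, h₆]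
  simp only [Polynomial.eval_sub, Polynomial.eval_add, Polynomial.eval_mul, Polynomial.eval_pow,
    Polynomial.eval_X, Polynomial.eval_C]
  ring

theorem HasMoments.three_mul_sub_sq_pos (h : HasMoments ρ c) (hc : 0 < c 2) :
    0 < 3 * c 2 - c 1 ^ 2 := by
  linarith [h.sq_apply_le 1]

theorem HasMoments.integral_gramSchmidtPoly_four_mul_two_gaussianMixture (h : HasMoments ρ c)
    (hc : 0 < c 2) :
    ∫ v : EuclideanSpace ℝ (Fin 2), (gramSchmidtPoly (gaussianMixture ρ ℝ) 4).eval (v 0) *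
        (gramSchmidtPoly (gaussianMixture ρ ℝ) 2).eval (v 1) ∂gaussianMixture ρ _ =
      6 / (3 * c 2 - c 1 ^ 2) * (2 * c 1 ^ 2 * c 3 - (c 2 * c 3 + c 1 * c 2 ^ 2)) := by
  have hden := h.three_mul_sub_sq_pos hc
  set r := (15 * c 3 - 3 * c 1 * c 2) / (3 * c 2 - c 1 ^ 2) with hr
  have hexpand := h.integral_even_mul_even_gaussianMixture ![r * c 1 - 3 * c 2, -r, 1] ![-c 1, 1]
  norm_num [Fin.sum_univ_succ, Nat.doubleFactorial, h.apply_zero] at hexpand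
  calc _ = 3 * c 3 - 3 * (c 1 * c 2) - r * (c 2 - c 1 ^ 2) := by
        simp only [h.eval_gramSchmidtPoly_two_gaussianMixture,
          h.eval_gramSchmidtPoly_four_gaussianMixture, ← hr]
        convert! hexpand using 1
        · congr with v
          ring
        · ring
    _ = _ := by
        rw [hr]
        field_simp
        ring

end ProductIntegral

/-! ### The Gamma function inequality -/

theorem ofReal_rpow_mul_one_sub_rpow (a b : ℝ) {x : ℝ} (hx : x ∈ Set.uIcc 0 1) :
    ((x ^ a * (1 - x) ^ b : ℝ) : ℂ) =
      (x : ℂ) ^ (((a + 1 : ℝ) : ℂ) - 1) * (1 - (x : ℂ)) ^ (((b + 1 : ℝ) : ℂ) - 1) := by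
  rw [Set.uIcc_of_le zero_le_one] at hx
  rw [Complex.ofReal_mul, Complex.ofReal_cpow hx.1, Complex.ofReal_cpow (sub_nonneg.2 hx.2)]
  simp

theorem intervalIntegrable_rpow_mul_one_sub_rpow {a b : ℝ} (ha : -1 < a) (hb : -1 < b) :
    IntervalIntegrable (fun x : ℝ => x ^ a * (1 - x) ^ b) volume 0 1 := by
  have hbeta := Complex.betaIntegral_convergent (u := (a + 1 : ℝ)) (v := (b + 1 : ℝ))
    (by simpa using neg_lt_iff_pos_add.1 ha) (by simpa using neg_lt_iff_pos_add.1 hb)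
  have hreal := hbeta.congr fun x hx =>
    (ofReal_rpow_mul_one_sub_rpow a b (Set.uIoc_subset_uIcc hx)).symm
  rw [intervalIntegrable_iff] at hreal ⊢
  exact hreal.re

theorem integral_rpow_mul_one_sub_rpow {a b : ℝ} (ha : -1 < a) (hb : -1 < b) :
    ∫ x in (0 : ℝ)..1, x ^ a * (1 - x) ^ b =
      Real.Gamma (a + 1) * Real.Gamma (b + 1) / Real.Gamma (a + 1 + (b + 1)) := by
  have hbeta := Complex.betaIntegral_eq_Gamma_mul_div (a + 1 : ℝ) (b + 1 : ℝ)
    (by simpa using neg_lt_iff_pos_add.1 ha) (by simpa using neg_lt_iff_pos_add.1 hb)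
  rw [Complex.betaIntegral, intervalIntegral.integral_congr fun x hx =>
      (ofReal_rpow_mul_one_sub_rpow a b hx).symm,
    intervalIntegral.integral_ofReal, ← Complex.ofReal_add, Complex.Gamma_ofReal,
    Complex.Gamma_ofReal, Complex.Gamma_ofReal] at hbeta
  exact_mod_cast hbeta

section GammaInequality

variable {β : ℝ}

-- The discriminant is `3 (3 β + 1) (β - 1)`.
theorem three_add_mul_add_mul_sq_pos (hβ : -1 / 3 < β) (hβ' : β < 1) (q : ℝ) :
    0 < 3 + -(3 * (β + 1)) * q + (2 * β + 1) * q ^ 2 := by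
  nlinarith [sq_nonneg (2 * (2 * β + 1) * q - 3 * (β + 1)),
    mul_pos (show 0 < 3 * β + 1 by linarith) (sub_pos.2 hβ')]

theorem integral_quadratic_rpow_mul_one_sub_rpow_pos (hβ : -1 / 3 < β) (hβ' : β < 1) {a b c : ℝ}
    (hquad : ∀ q, 0 < a + b * q + c * q ^ 2) :
    0 < a * (∫ x in (0 : ℝ)..1, x ^ β * (1 - x) ^ (-β)) +
      b * (∫ x in (0 : ℝ)..1, x ^ (β * 2) * (1 - x) ^ (-β)) +
      c * ∫ x in (0 : ℝ)..1, x ^ (β * 3) * (1 - x) ^ (-β) := by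
  have hint {s : ℝ} (hs : -1 < s) := intervalIntegrable_rpow_mul_one_sub_rpow hs (neg_lt_neg hβ')
  have h₁ := (hint (s := β) (by linarith)).const_mul a
  have h₂ := (hint (s := β * 2) (by linarith)).const_mul b
  have h₃ := (hint (s := β * 3) (by linarith)).const_mul c
  simp only [← intervalIntegral.integral_const_mul]
  rw [← intervalIntegral.integral_add h₁ h₂, ← intervalIntegral.integral_add (h₁.add h₂) h₃]
  refine intervalIntegral.intervalIntegral_pos_of_pos_on ((h₁.add h₂).add h₃) (fun x hx => ?_)
    one_pos
  calc 0 < x ^ β * (1 - x) ^ (-β) * (a + b * x ^ β + c * (x ^ β) ^ 2) :=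
      mul_pos (mul_pos (Real.rpow_pos_of_pos hx.1 _) (Real.rpow_pos_of_pos (sub_pos.2 hx.2) _))
        (hquad _)
    _ = _ := by
      rw [Real.rpow_mul hx.1.le β 2, Real.rpow_mul hx.1.le β 3, Real.rpow_ofNat, Real.rpow_ofNat]
      ring

theorem integral_rpow_mul_add_one_mul_one_sub_rpow (hβ : 0 ≤ β) (hβ' : β < 1) (n : ℕ) :
    ∫ x in (0 : ℝ)..1, x ^ (β * (n + 1 : ℕ)) * (1 - x) ^ (-β) =
      Real.Gamma (1 - β) * ((n + 1) / (β * n + 1)) *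
        (mittagLefflerMoment β n / mittagLefflerMoment β (n + 1)) := by
  have hGamma : Real.Gamma (β * (n + 1 : ℕ) + 1 + (-β + 1)) =
      (β * n + 1) * Real.Gamma (β * n + 1) := by
    rw [← Real.Gamma_add_one (by positivity)]
    push_cast
    ring_nf
  have hn := (Gamma_mul_natCast_add_one_pos hβ n).ne'
  have hsucc := (Gamma_mul_natCast_add_one_pos hβ (n + 1)).ne'
  rw [integral_rpow_mul_one_sub_rpow (neg_one_lt_zero.trans_le (by positivity)) (neg_lt_neg hβ'),
    hGamma, ← sub_eq_neg_add, mittagLefflerMoment, mittagLefflerMoment, Nat.factorial_succ]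
  push_cast at hsucc ⊢
  field_simp

theorem two_mul_mittagLefflerMoment_one_sq_mul_three_lt (hβ : 0 < β) (hβ' : β < 1) :
    2 * mittagLefflerMoment β 1 ^ 2 * mittagLefflerMoment β 3 <
      mittagLefflerMoment β 2 * mittagLefflerMoment β 3 +
        mittagLefflerMoment β 1 * mittagLefflerMoment β 2 ^ 2 := by
  have hpos := integral_quadratic_rpow_mul_one_sub_rpow_pos (by linarith) hβ'
    (three_add_mul_add_mul_sq_pos (by linarith) hβ')
  have h₁ := integral_rpow_mul_add_one_mul_one_sub_rpow hβ.le hβ' 0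
  have h₂ := integral_rpow_mul_add_one_mul_one_sub_rpow hβ.le hβ' 1
  have h₃ := integral_rpow_mul_add_one_mul_one_sub_rpow hβ.le hβ' 2
  norm_num [mittagLefflerMoment_zero] at h₁ h₂ h₃
  rw [h₁, h₂, h₃] at hpos
  have hΓ : 0 < Real.Gamma (1 - β) := Real.Gamma_pos_of_pos (sub_pos.2 hβ')
  have hc₁ := mittagLefflerMoment_pos hβ.le 1
  have hc₂ := mittagLefflerMoment_pos hβ.le 2
  have hc₃ := mittagLefflerMoment_pos hβ.le 3
  set c := mittagLefflerMoment β
  have hfactor : 3 * (Real.Gamma (1 - β) * (c 1)⁻¹) +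
      -(3 * (β + 1)) * (Real.Gamma (1 - β) * (2 / (β + 1)) * (c 1 / c 2)) +
      (2 * β + 1) * (Real.Gamma (1 - β) * (3 / (β * 2 + 1)) * (c 2 / c 3)) =
      3 * Real.Gamma (1 - β) / (c 1 * c 2 * c 3) *
        (c 2 * c 3 + c 1 * c 2 ^ 2 - 2 * c 1 ^ 2 * c 3) := by
    field_simp
    ring
  rw [hfactor] at hpos
  exact sub_pos.1 (pos_of_mul_pos_right hpos (by positivity))

end GammaInequality

theorem mainTheorem3 (β : ℝ) (hβ : 0 < β) (hβ' : β ≤ 1) :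
    Integrable (fun v : EuclideanSpace ℝ (Fin 2) =>
        (mittagLefflerPoly β 4).eval (v 0) * (mittagLefflerPoly β 2).eval (v 1))
      (mittagLefflerMeasure β (EuclideanSpace ℝ (Fin 2))) ∧
    ((∫ v : EuclideanSpace ℝ (Fin 2),
        (mittagLefflerPoly β 4).eval (v 0) * (mittagLefflerPoly β 2).eval (v 1)
          ∂(mittagLefflerMeasure β (EuclideanSpace ℝ (Fin 2)))) = 0 ↔ β = 1) := by
  obtain ⟨ρ, h⟩ := isStieltjesMomentSeq_mittagLefflerMoment hβ.le hβ'
  have hc (m : ℕ) : 0 < mittagLefflerMoment β m := mittagLefflerMoment_pos hβ.le m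
  have hden := h.three_mul_sub_sq_pos (hc 2)
  simp only [mittagLefflerPoly, h.mittagLefflerMeasure_eq_gaussianMixture hβ]
  refine ⟨h.integrable_eval_mul_eval_gaussianMixture _ _, ?_⟩
  rw [h.integral_gramSchmidtPoly_four_mul_two_gaussianMixture (hc 2),
    mul_eq_zero_iff_left (by positivity), sub_eq_zero]
  refine ⟨fun heq => ?_, ?_⟩
  · by_contra hne
    exact (two_mul_mittagLefflerMoment_one_sq_mul_three_lt hβ (hβ'.lt_of_ne hne)).ne heq
  · rintro rfl
    norm_num [mittagLefflerMoment_one_left]
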